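/- **Setting.** Let $s\ge 0$ and let $M_l\ge 0$, $N_l\ge 0$ ($1\le l\le s$) be real numbers. Put $S=\bigcup_{l}[-M_l-N_l,-M_l]$, $S^+=\bigcup_l[M_l,M_l+N_l]$, $R^s=[0,\infty)\setminus S^+$, and $T=S\cup[0,\infty)$; the observation times are $\mathbb R^-\setminus S=(-\infty,0)\setminus S$. Let $a:\mathbb R\to\mathbb C$ satisfy $\int_{R^s}|a(t)|\,dt<\infty$, $\int_{R^s}t|a(t)|^2dt<\infty$, and let $A(\lambda)=\int_{R^s}a(t)e^{-it\lambda}dt$. A spectral density is an integrable function on $\mathbb R$ that is nonnegative almost everywhere. For spectral densities $f$ (of the signal $\xi$) and $g$ (of the uncorrelated noise $\eta$) let $L_2^s(f+g)$ be the closed linear span in $L_2(f+g)$ of the functions $e^{it\lambda}$, $t\in\mathbb R^-\setminus S$. The mean-square error of the linear estimate of $A\xi=\int_{R^s}a(t)\xi(-t)dt$ from $\xi(t)+\eta(t)$, $t\in\mathbb R^-\setminus S$, with spectral characteristic $h\in L_2^s(f+g)$ is $$\Delta(h;f,g)=\frac1{2\pi}\int_{\mathbb R}|A-h|^2f\,d\lambda+\frac1{2\pi}\int_{\mathbb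 R}|h|^2g\,d\lambda ,$$ and the optimal characteristic $h(f,g)$ minimizes it over $L_2^s(f+g)$; $\Delta(f,g)=\Delta(h(f,g);f,g)$. Let $D=D_{\varepsilon_1}\times D^1_{\varepsilon_2}$, where $0\le\varepsilon_1\le1$, $\varepsilon_2,P_1\in\mathbb R$, $f_1,g_1$ are fixed spectral densities, $D_{\varepsilon_1}$ is the set of spectral densities $f=(1-\varepsilon_1)f_1+\varepsilon_1w$ with $w$ a spectral density and $\frac1{2\pi}\int f\,d\lambda\le P_1$, and $D^1_{\varepsilon_2}$ is the set of spectral densities $g$ with $\frac1{2\pi}\int|g-g_1|\,d\lambda\le\varepsilon_2$. A pair $(f_0,g_0)\in D$ is *least favorable* in $D$ if $\Delta(f_0,g_0)=\max_{(f,g)\in D}\Delta(f,g)$. A function $h^0$ is *minimax-robust* for $D$ if $h^0\in H_D=\bigcap_{(f,g)\in D}L_2^s(f+g)$, the maximum of $\Delta(h^0;f,g)$ over $(f,g)\in D$ is attained, and $\max_{D}\Delta(h^0;f,g)\le\sup_{D}\Delta(h;f,g)$ for all $h\in H_D$. **Operators.** Represent a function $x$ on $T$ by its transform $X(\lambda)=\int_Tx(t)e^{it\lambda}dt$,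 so that $x(t)=\frac1{2\pi}\int X(\lambda)e^{-it\lambda}d\lambda$ vanishes for $t\in\mathbb R^-\setminus S$. The operators $B,R,Q$ (depending on $f,g$) are given by $$\langle Bx,y\rangle=\frac1{2\pi}\int\frac{X\overline Y}{f+g}d\lambda,\quad \langle Ra,y\rangle=\frac1{2\pi}\int\frac{Af\,\overline Y}{f+g}d\lambda,\quad \langle Qa,a\rangle=\frac1{2\pi}\int\frac{|A|^2fg}{f+g}d\lambda$$ on the form domain of $B$, the measurable $X$ with $\int\frac{|X|^2}{f+g}d\lambda<\infty$ and $x=0$ on $\mathbb R^-\setminus S$ (quotients in $[0,\infty]$ with $0/0=0$ in this condition). The equation $c=B^{-1}Ra$ means that $c$ lies in the form domain and $\langle Bc,y\rangle=\langle Ra,y\rangle$ for all $y$ in it; $C$ denotes the transform of $c$. **Theorem.** Let $f_0\in D_{\varepsilon_1}$, $g_0\in D^1_{\varepsilon_2}$ satisfy the minimality condition $\int\frac{|\gamma|^2}{f_0+g_0}d\lambda<\infty$ for some nontrivial function of exponential type $\gamma(\lambda)=\int_0^\infty\alpha(t)e^{it\lambda}dt$, $\alpha\in L_1(0,\infty)$.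 Let $C^0$ be the transform of $(B^0)^{-1}R^0a$, where $B^0,R^0,Q^0$ are the operators for $(f_0,g_0)$, and let $$h_f=\frac{|Ag_0+C^0|^2}{(f_0+g_0)^2},\qquad h_g=\frac{|Af_0-C^0|^2}{(f_0+g_0)^2}$$ be (essentially) bounded. Suppose that, almost everywhere, $$|Ag_0+C^0|=(f_0+g_0)(\varphi+\alpha_1^{-1}),\qquad |Af_0-C^0|^2=(f_0+g_0)^k\,\Psi\,\alpha_2,$$ with $k=1$ or $k=2$, real constants $\alpha_1\ne0$, $\alpha_2$, and real functions $\varphi,\Psi$ such that $\varphi\le0$, $\varphi=0$ where $f_0>(1-\varepsilon_1)f_1$, $|\Psi|\le1$, and $\Psi=\operatorname{sign}(g_0-g_1)$ where $g_0\ne g_1$. Suppose further that $(f_0,g_0)$ solves the optimization problem $$\max_{(f,g)\in D}\big(\langle Ra,B^{-1}Ra\rangle+\langle Qa,a\rangle\big)=\langle R^0a,(B^0)^{-1}R^0a\rangle+\langle Q^0a,a\rangle .$$ Then $(f_0,g_0)$ is least favorable in $D$, and $$h^0=A\,\frac{f_0}{f_0+g_0}-\frac{C^0}{f_0+g_0}$$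 is the optimal spectral characteristic $h(f_0,g_0)$ and is minimax-robust for $D$. -/

import Mathlib

open MeasureTheory
open scoped ENNReal ComplexConjugate

noncomputable section

namespace MissingObsFiltering

/-! ### Observation geometry -/

/-- The missing set `S = ⋃ₗ [-Mₗ - Nₗ, -Mₗ]`. -/
def missing {s : ℕ} (M N : Fin s → ℝ) : Set ℝ := ⋃ l, Set.Icc (-M l - N l) (-M l)

/-- The reflected set `S⁺ = ⋃ₗ [Mₗ, Mₗ + Nₗ]`. -/
def missingPos {s : ℕ} (M N : Fin s → ℝ) : Set ℝ := ⋃ l, Set.Icc (M l) (M l + N l)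

/-- The observation times `ℝ⁻ \ S`. -/
def observed {s : ℕ} (M N : Fin s → ℝ) : Set ℝ := Set.Iio 0 \ missing M N

/-- The set `Rˢ = [0, ∞) \ S⁺` over which the functional integrates. -/
def funcSupport {s : ℕ} (M N : Fin s → ℝ) : Set ℝ := Set.Ici 0 \ missingPos M N

/-- `A(e^{iλ}) = ∫_{Rˢ} a(t) e^{-itλ} dt`. -/
def symbolA (Rs : Set ℝ) (a : ℝ → ℂ) (lam : ℝ) : ℂ :=
  ∫ t in Rs, a t * Complex.exp (-(Complex.I * t * lam))

/-! ### Spectral densities, estimates and mean-square errors -/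

/-- A spectral density of a stationary process on `ℝ` with finite second moment. -/
def IsSpectralDensity (f : ℝ → ℝ) : Prop := Integrable f ∧ ∀ᵐ x, 0 ≤ f x

/-- The measure with density `f + g`. -/
def specMeasure (f g : ℝ → ℝ) : Measure ℝ :=
  volume.withDensity fun x => ENNReal.ofReal (f x + g x)

/-- The function `λ ↦ e^{itλ}`. -/
def character (t : ℝ) : ℝ → ℂ := fun lam => Complex.exp (Complex.I * t * lam)

/-- `L₂ˢ(f+g)`: the functions in `L₂(f+g)` that are `L₂(f+g)`-limits of linear combinations of
`e^{itλ}`, where `t` runs through the set `O` of observation times. -/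
def L2s (O : Set ℝ) (f g : ℝ → ℝ) : Set (ℝ → ℂ) :=
  {h | MemLp h 2 (specMeasure f g) ∧
    ∀ ε : ℝ≥0∞, 0 < ε → ∃ p ∈ Submodule.span ℂ (character '' O),
      eLpNorm (h - p) 2 (specMeasure f g) ≤ ε}

/-- The mean-square error
`Δ(h; f, g) = (1/2π) ∫ |A - h|² f dλ + (1/2π) ∫ |h|² g dλ`
of the linear estimate with spectral characteristic `h`. -/
def Delta (A h : ℝ → ℂ) (f g : ℝ → ℝ) : ℝ≥0∞ :=
  ENNReal.ofReal (1 / (2 * Real.pi)) * (∫⁻ x, ‖A x - h x‖ₑ ^ 2 * ENNReal.ofReal (f x)) +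
  ENNReal.ofReal (1 / (2 * Real.pi)) * (∫⁻ x, ‖h x‖ₑ ^ 2 * ENNReal.ofReal (g x))

/-- `h` is the spectral characteristic `h(f, g)` of the optimal linear estimate. -/
def IsOptimal (O : Set ℝ) (A h : ℝ → ℂ) (f g : ℝ → ℝ) : Prop :=
  h ∈ L2s O f g ∧ ∀ h' ∈ L2s O f g, Delta A h f g ≤ Delta A h' f g

/-- The error `Δ(f, g)` of the optimal linear estimate: the least value of `Δ(h; f, g)`
over `h ∈ L₂ˢ(f+g)`. -/
def optDelta (O : Set ℝ) (A : ℝ → ℂ) (f g : ℝ → ℝ) : ℝ≥0∞ :=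
  ⨅ h ∈ L2s O f g, Delta A h f g

/-- The minimality condition: `∫ |γ|² / (f + g) dλ < ∞` for a nontrivial function of exponential
type `γ(λ) = ∫₀^∞ α(t) e^{itλ} dt`. The quotient is taken in `[0, ∞]`. -/
def Minimality (f g : ℝ → ℝ) : Prop :=
  ∃ (α : ℝ → ℂ) (Γ : ℂ → ℂ),
    IntegrableOn α (Set.Ici 0) ∧
    Differentiable ℂ Γ ∧ (∃ K τ : ℝ, ∀ z, ‖Γ z‖ ≤ K * Real.exp (τ * ‖z‖)) ∧
    (∀ x : ℝ, Γ x = ∫ t in Set.Ici (0 : ℝ), α t * Complex.exp (Complex.I * t * x)) ∧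
    (∃ x : ℝ, Γ x ≠ 0) ∧
    ∫⁻ x : ℝ, ‖Γ x‖ₑ ^ 2 / ENNReal.ofReal (f x + g x) < ⊤

/-! ### Least favorable densities and minimax-robust characteristics -/

/-- `(f₀, g₀)` is least favorable in `D`: it belongs to `D`, its optimal estimate exists, and
`Δ(f₀, g₀) = Δ(h(f₀, g₀); f₀, g₀)` is the maximum of `Δ(f, g)` over `D`. -/
def LeastFavorable (O : Set ℝ) (A : ℝ → ℂ) (D : Set ((ℝ → ℝ) × (ℝ → ℝ))) (f₀ g₀ : ℝ → ℝ) :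
    Prop :=
  (f₀, g₀) ∈ D ∧
  (∃ h, IsOptimal O A h f₀ g₀ ∧ Delta A h f₀ g₀ = optDelta O A f₀ g₀) ∧
  ∀ q ∈ D, optDelta O A q.1 q.2 ≤ optDelta O A f₀ g₀

/-- `H_D = ⋂_{(f, g) ∈ D} L₂ˢ(f+g)`. -/
def HD (O : Set ℝ) (D : Set ((ℝ → ℝ) × (ℝ → ℝ))) : Set (ℝ → ℂ) :=
  {h | ∀ q ∈ D, h ∈ L2s O q.1 q.2}

/-- `h⁰` is minimax-robust: `h⁰ ∈ H_D`, the maximum of `Δ(h⁰; f, g)` over `D` is attained, and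
`h⁰` minimizes `sup_{(f, g) ∈ D} Δ(h; f, g)` over `h ∈ H_D`. -/
def MinimaxRobust (O : Set ℝ) (A : ℝ → ℂ) (D : Set ((ℝ → ℝ) × (ℝ → ℝ))) (h₀ : ℝ → ℂ) : Prop :=
  h₀ ∈ HD O D ∧
  (∃ p ∈ D, ∀ q ∈ D, Delta A h₀ q.1 q.2 ≤ Delta A h₀ p.1 p.2) ∧
  ∀ h ∈ HD O D, (⨆ q ∈ D, Delta A h₀ q.1 q.2) ≤ ⨆ q ∈ D, Delta A h q.1 q.2

/-! ### The operators `B`, `R`, `Q`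

A function `x` on `T = S ∪ [0, ∞)` is represented by its transform `X(λ) = ∫_T x(t) e^{itλ} dt`,
so that `x(t) = (1/2π) ∫ X(λ) e^{-itλ} dλ`. In terms of the transforms,

* `⟨B x, y⟩ = (1/2π) ∫ X conj(Y) / (f+g) dλ`,
* `⟨R a, y⟩ = (1/2π) ∫ A f / (f+g) conj(Y) dλ`,
* `⟨Q a, a⟩ = (1/2π) ∫ |A|² f g / (f+g) dλ`.

As `f + g` is integrable over `ℝ`, the function `1/(f+g)` never is, and the kernel of `B` is only
formal: `B` is the (unbounded, positive) operator given by its quadratic form on the functions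
with `⟨B x, x⟩ < ∞`. -/

/-- The function `x(t) = (1/2π) ∫ X(λ) e^{-itλ} dλ` with transform `X`. -/
def timeFn (X : ℝ → ℂ) (t : ℝ) : ℂ :=
  (1 / (2 * Real.pi) : ℝ) * ∫ lam : ℝ, X lam * Complex.exp (-(Complex.I * t * lam))

/-- The form domain of `B`: transforms `X` of functions `x` that vanish at all observation times
(that is, outside `T`) with `⟨B x, x⟩ = (1/2π) ∫ |X|² / (f+g) dλ < ∞`. The quotient is taken in
`[0, ∞]`, so that `X = 0` almost everywhere on `{f + g = 0}`. By the Cauchy--Schwarz inequality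
such an `X` is integrable; if `f + g` is bounded, then `X` is square integrable and `x` lies in
`L₂(T)`. -/
def formDomain (O : Set ℝ) (f g : ℝ → ℝ) : Set (ℝ → ℂ) :=
  {X | AEStronglyMeasurable X volume ∧
    (∫⁻ x : ℝ, ‖X x‖ₑ ^ 2 / ENNReal.ofReal (f x + g x)) < ⊤ ∧
    ∀ t ∈ O, timeFn X t = 0}

/-- `⟨B x, y⟩`. -/
def formB (f g : ℝ → ℝ) (X Y : ℝ → ℂ) : ℂ :=
  (1 / (2 * Real.pi) : ℝ) * ∫ x : ℝ, ((1 / (f x + g x) : ℝ) : ℂ) * X x * conj (Y x)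

/-- `⟨R a, y⟩`. -/
def formR (A : ℝ → ℂ) (f g : ℝ → ℝ) (Y : ℝ → ℂ) : ℂ :=
  (1 / (2 * Real.pi) : ℝ) * ∫ x : ℝ, ((f x / (f x + g x) : ℝ) : ℂ) * A x * conj (Y x)

/-- `⟨Q a, a⟩`. -/
def formQ (A : ℝ → ℂ) (f g : ℝ → ℝ) : ℝ :=
  (1 / (2 * Real.pi)) * ∫ x : ℝ, f x * g x / (f x + g x) * ‖A x‖ ^ 2

/-- `C` is the transform of `c = B⁻¹ R a`, that is `B c = R a`. -/
def IsBinvRa (O : Set ℝ) (A : ℝ → ℂ) (f g : ℝ → ℝ) (C : ℝ → ℂ) : Prop :=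
  C ∈ formDomain O f g ∧ ∀ Y ∈ formDomain O f g, formB f g C Y = formR A f g Y

/-- `⟨R a, B⁻¹ R a⟩ + ⟨Q a, a⟩`, where `C` is the transform of `B⁻¹ R a`. -/
def extremValue (A : ℝ → ℂ) (f g : ℝ → ℝ) (C : ℝ → ℂ) : ℝ :=
  (formR A f g C).re + formQ A f g

/-- `(f₀, g₀)`, with `C⁰` the transform of `(B⁰)⁻¹ R⁰ a`, solves the constrained optimization
problem of maximizing `⟨R a, B⁻¹ R a⟩ + ⟨Q a, a⟩` over `D`. -/
def SolvesExtrem (O : Set ℝ) (A : ℝ → ℂ) (D : Set ((ℝ → ℝ) × (ℝ → ℝ))) (f₀ g₀ : ℝ → ℝ)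
    (C₀ : ℝ → ℂ) : Prop :=
  (f₀, g₀) ∈ D ∧ IsBinvRa O A f₀ g₀ C₀ ∧
  ∀ q ∈ D, ∀ C, IsBinvRa O A q.1 q.2 C → extremValue A q.1 q.2 C ≤ extremValue A f₀ g₀ C₀

/-- The spectral characteristic `h = A f / (f+g) - C / (f+g)`. -/
def charFormula (A : ℝ → ℂ) (f g : ℝ → ℝ) (C : ℝ → ℂ) (x : ℝ) : ℂ :=
  A x * ((f x / (f x + g x) : ℝ) : ℂ) - C x / ((f x + g x : ℝ) : ℂ)

/-- `h_f(f₀, g₀) = |A g₀ + C⁰|² / (f₀ + g₀)²`. -/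
def hf (A : ℝ → ℂ) (f g : ℝ → ℝ) (C : ℝ → ℂ) (x : ℝ) : ℝ :=
  ‖A x * (g x : ℂ) + C x‖ ^ 2 / (f x + g x) ^ 2

/-- `h_g(f₀, g₀) = |A f₀ - C⁰|² / (f₀ + g₀)²`. -/
def hg (A : ℝ → ℂ) (f g : ℝ → ℝ) (C : ℝ → ℂ) (x : ℝ) : ℝ :=
  ‖A x * (f x : ℂ) - C x‖ ^ 2 / (f x + g x) ^ 2

/-! ### The classes of admissible densities -/

/-- The `ε`-contamination class `D_{ε₁}` with the power bound `P₁`. -/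
def contamClass (ε₁ P₁ : ℝ) (f₁ : ℝ → ℝ) : Set (ℝ → ℝ) :=
  {f | IsSpectralDensity f ∧
    (∃ w, IsSpectralDensity w ∧ ∀ᵐ x, f x = (1 - ε₁) * f₁ x + ε₁ * w x) ∧
    1 / (2 * Real.pi) * ∫ x, f x ≤ P₁}

/-- The `L₁`-ball `D¹_{ε₂}` around `g₁`. -/
def l1Class (ε₂ : ℝ) (g₁ : ℝ → ℝ) : Set (ℝ → ℝ) :=
  {g | IsSpectralDensity g ∧ 1 / (2 * Real.pi) * ∫ x, |g x - g₁ x| ≤ ε₂}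

end MissingObsFiltering

end

namespace MissingObsFiltering

open Filter Topology

/-! Completing the square (`Delta_eq`) turns the error of `h` into the squared distance in L₂(f+g)
from `h` to `A f / (f+g)`, plus a term free of `h`. The map X ↦ X / (f+g) identifies the form domain
of `B` with the orthogonal complement of L₂ˢ(f+g), so solving B c = R a splits `A f / (f+g)`
orthogonally: the component in L₂ˢ is `charFormula`, and the optimal error is `extremValue`. Hence
the extremal problem is the maximization of the optimal error V, which gives least favorability.

Robustness needs a saddle point (`charFormula_mem_and_Delta_le`): h⁰ must lie in L₂ˢ(f'+g') for
every (f', g') in D, with error there at most V(f₀, g₀). For fixed `p` the error is affine in the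
densities, and D is convex. Let `p` be a trigonometric polynomial that is optimal up to t² at
parameter t of the segment from (f₀, g₀) to (f', g'). Maximality of V(f₀, g₀) then forces `p` to be
close to h⁰ in L₂(f₀+g₀) and its error at (f', g') to be at most V(f₀, g₀) + t
(`exists_mem_span_near`).

As t → 0 these polynomials are only bounded in L₂(f'+g'). A nearest-point argument on decreasing
convex sets (`exists_tendsto_of_antitone_convex`) selects a strongly convergent sequence. Its limit
is h⁰, by convergence almost everywhere along subsequences and by positivity of f₀+g₀ almost
everywhere, which the minimality condition supplies. -/

/-- A decreasing sequence of convex sets, each meeting every ball around `c` of squared radius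
greater than `R`, has a convergent sequence of elements whose limit is at squared distance at most
`R` from `c`. -/
lemma exists_tendsto_of_antitone_convex {E : Type*} [NormedAddCommGroup E] [InnerProductSpace ℂ E]
    [CompleteSpace E] {K : ℕ → Set E} (hK : Antitone K)
    (hmid : ∀ n, ∀ x ∈ K n, ∀ y ∈ K n, (2⁻¹ : ℂ) • (x + y) ∈ K n) (c : E) (R : ℝ)
    (hR : ∀ n, ∀ ε > 0, ∃ x ∈ K n, ‖x - c‖ ^ 2 ≤ R + ε) :
    ∃ (x : ℕ → E) (y : E), (∀ n, x n ∈ K n) ∧ Tendsto x atTop (𝓝 y) ∧ ‖y - c‖ ^ 2 ≤ R := by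
  set S : ℕ → Set ℝ := fun n => (fun x => ‖x - c‖ ^ 2) '' K n
  have hbdd : ∀ n, BddBelow (S n) := fun n => ⟨0, by rintro _ ⟨x, -, rfl⟩; positivity⟩
  have hne : ∀ n, (S n).Nonempty := fun n => by
    obtain ⟨x, hx, -⟩ := hR n 1 one_pos
    exact ⟨_, x, hx, rfl⟩
  set D : ℕ → ℝ := fun n => sInf (S n)
  have hD : ∀ n, ∀ x ∈ K n, D n ≤ ‖x - c‖ ^ 2 := fun n x hx => csInf_le (hbdd n) ⟨x, hx, rfl⟩
  have hDR : ∀ n, D n ≤ R := fun n => le_of_forall_pos_le_add fun ε hε => by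
    obtain ⟨x, hx, h⟩ := hR n ε hε
    exact (hD n x hx).trans h
  have hDmono : Monotone D := fun n m h => csInf_le_csInf (hbdd n) (hne m) (Set.image_mono (hK h))
  have hlim := tendsto_atTop_ciSup hDmono ⟨R, by rintro _ ⟨n, rfl⟩; exact hDR n⟩
  set L := ⨆ n, D n
  have hDL : ∀ n, D n ≤ L := fun n => le_ciSup (f := D) ⟨R, by rintro _ ⟨n, rfl⟩; exact hDR n⟩ n
  have hex : ∀ n : ℕ, ∃ x ∈ K n, ‖x - c‖ ^ 2 < D n + 1 / ((n : ℝ) + 1) := fun n => by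
    obtain ⟨_, ⟨x, hx, rfl⟩, h⟩ := exists_lt_of_csInf_lt (hne n)
      (lt_add_of_pos_right (D n) (by positivity : 0 < 1 / ((n : ℝ) + 1)))
    exact ⟨x, hx, h⟩
  choose x hxK hx using hex
  -- The midpoint of `x n` and `x m` lies in `K n`, hence at squared distance at least `D n` from
  -- `c`; the parallelogram law then bounds the gap, and `D n` tends to `L`.
  have hdist : ∀ n m, n ≤ m → ‖x n - x m‖ ^ 2 ≤ 2 * (L - D n) + 4 * (1 / ((n : ℝ) + 1)) := by
    intro n m hnm
    have hpar := parallelogram_law_with_norm ℂ (x n - c) (x m - c)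
    have hmd := hD n _ (hmid n _ (hxK n) _ (hK hnm (hxK m)))
    have e1 : (2⁻¹ : ℂ) • (x n + x m) - c = (2⁻¹ : ℂ) • ((x n - c) + (x m - c)) := by
      module
    have e2 : (x n - c) - (x m - c) = x n - x m := by abel
    rw [e1, norm_smul, mul_pow] at hmd
    rw [e2] at hpar
    have e3 : ‖(2⁻¹ : ℂ)‖ ^ 2 = 1 / 4 := by norm_num
    rw [e3] at hmd
    have h1 := hx n
    have h2 := hx m
    have h3 : 1 / ((m : ℝ) + 1) ≤ 1 / ((n : ℝ) + 1) := by gcongr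
    have h4 := hDL m
    linarith
  have hrate : Tendsto (fun n : ℕ => 2 * (L - D n) + 4 * (1 / ((n : ℝ) + 1))) atTop (𝓝 0) := by
    simpa using ((tendsto_const_nhds (x := L)).sub hlim).const_mul 2 |>.add
      (tendsto_one_div_add_atTop_nhds_zero_nat.const_mul 4)
  have hc : CauchySeq x := by
    refine Metric.cauchySeq_iff'.2 fun ε hε => ?_
    obtain ⟨n, hn⟩ := ((tendsto_order.1 hrate).2 (ε ^ 2) (by positivity)).exists
    refine ⟨n, fun m hm => ?_⟩
    rw [dist_comm, dist_eq_norm]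
    exact lt_of_pow_lt_pow_left₀ 2 hε.le ((hdist n m hm).trans_lt hn)
  obtain ⟨y, hy⟩ := cauchySeq_tendsto_of_complete hc
  refine ⟨x, y, hxK, hy, ?_⟩
  have h1 : Tendsto (fun n => ‖x n - c‖ ^ 2) atTop (𝓝 (‖y - c‖ ^ 2)) :=
    ((hy.sub_const c).norm).pow 2
  have h2 : Tendsto (fun n : ℕ => R + 1 / ((n : ℝ) + 1)) atTop (𝓝 R) := by
    simpa using tendsto_one_div_add_atTop_nhds_zero_nat.const_add R
  exact le_of_tendsto_of_tendsto' h1 h2 fun n => (hx n).le.trans (by gcongr; exact hDR n)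

/-! ### The symbol, trigonometric polynomials and the weight -/

lemma norm_exp_neg_I_mul (t x : ℝ) : ‖Complex.exp (-(Complex.I * t * x))‖ = 1 := by
  rw [Complex.norm_exp]; simp

lemma norm_character (t x : ℝ) : ‖character t x‖ = 1 := by
  rw [character, Complex.norm_exp]; simp

lemma conj_character (t x : ℝ) : conj (character t x) = Complex.exp (-(Complex.I * t * x)) := by
  rw [character, ← Complex.exp_conj]; simp

lemma continuous_character (t : ℝ) : Continuous (character t) := by
  unfold character; fun_prop

lemma continuous_symbolA {Rs : Set ℝ} {a : ℝ → ℂ} (ha : IntegrableOn a Rs) :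
    Continuous (symbolA Rs a) := by
  refine continuous_of_dominated (bound := fun t => ‖a t‖) (fun x => ?_) (fun x => ?_) ha.norm ?_
  · exact ha.aestronglyMeasurable.mul (by fun_prop)
  · exact .of_forall fun t => by rw [norm_mul, norm_exp_neg_I_mul, mul_one]
  · exact .of_forall fun t => by fun_prop

lemma norm_symbolA_le {Rs : Set ℝ} (a : ℝ → ℂ) (x : ℝ) :
    ‖symbolA Rs a x‖ ≤ ∫ t in Rs, ‖a t‖ := by
  refine (norm_integral_le_integral_norm _).trans (le_of_eq ?_)
  simp_rw [norm_mul, norm_exp_neg_I_mul, mul_one]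

lemma continuous_of_mem_span {O : Set ℝ} {p : ℝ → ℂ}
    (hp : p ∈ Submodule.span ℂ (character '' O)) : Continuous p := by
  induction hp using Submodule.span_induction with
  | mem x hx => obtain ⟨t, -, rfl⟩ := hx; exact continuous_character t
  | zero => exact continuous_const
  | add x y _ _ hx hy => exact hx.add hy
  | smul c x _ hx => exact hx.const_smul c

lemma bounded_of_mem_span {O : Set ℝ} {p : ℝ → ℂ}
    (hp : p ∈ Submodule.span ℂ (character '' O)) : ∃ K, ∀ x, ‖p x‖ ≤ K := by
  induction hp using Submodule.span_induction with
  | mem x hx => obtain ⟨t, -, rfl⟩ := hx; exact ⟨1, fun x => (norm_character t x).le⟩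
  | zero => exact ⟨0, fun x => by simp⟩
  | add x y _ _ hx hy =>
    obtain ⟨K, hK⟩ := hx
    obtain ⟨L, hL⟩ := hy
    exact ⟨K + L, fun x => (norm_add_le _ _).trans (add_le_add (hK x) (hL x))⟩
  | smul c x _ hx =>
    obtain ⟨K, hK⟩ := hx
    exact ⟨‖c‖ * K, fun x => by
      simpa [norm_smul] using mul_le_mul_of_nonneg_left (hK x) (norm_nonneg c)⟩

/-! ### The weight f + g and its measure. -/

section Weight

variable {f g : ℝ → ℝ}

lemma IsSpectralDensity.ae_add_nonneg (hf : IsSpectralDensity f) (hg : IsSpectralDensity g) :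
    ∀ᵐ x, 0 ≤ f x + g x := by
  filter_upwards [hf.2, hg.2] with x h1 h2 using add_nonneg h1 h2

lemma IsSpectralDensity.aemeasurable_add (hf : IsSpectralDensity f) (hg : IsSpectralDensity g) :
    AEMeasurable (fun x => f x + g x) := (hf.1.add hg.1).aemeasurable

lemma IsSpectralDensity.aemeasurable_weight (hf : IsSpectralDensity f)
    (hg : IsSpectralDensity g) : AEMeasurable (fun x => ENNReal.ofReal (f x + g x)) :=
  (hf.aemeasurable_add hg).ennreal_ofReal

lemma isFiniteMeasure_specMeasure (hf : IsSpectralDensity f) (hg : IsSpectralDensity g) :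
    IsFiniteMeasure (specMeasure f g) :=
  isFiniteMeasure_withDensity_ofReal (hf.1.add hg.1).2

lemma specMeasure_ae_iff (hf : IsSpectralDensity f) (hg : IsSpectralDensity g) {p : ℝ → Prop} :
    (∀ᵐ x ∂specMeasure f g, p x) ↔ ∀ᵐ x, 0 < f x + g x → p x := by
  rw [specMeasure, ae_withDensity_iff' (hf.aemeasurable_weight hg)]
  simp only [ne_eq, ENNReal.ofReal_eq_zero, not_le]

lemma specMeasure_absolutelyContinuous : specMeasure f g ≪ volume :=
  withDensity_absolutelyContinuous _ _

lemma lintegral_specMeasure (hf : IsSpectralDensity f) (hg : IsSpectralDensity g)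
    {F : ℝ → ℝ≥0∞} (hF : AEMeasurable F) :
    ∫⁻ x, F x ∂specMeasure f g = ∫⁻ x, ENNReal.ofReal (f x + g x) * F x := by
  rw [specMeasure, lintegral_withDensity_eq_lintegral_mul₀ (hf.aemeasurable_weight hg) hF]
  rfl

lemma integral_specMeasure (hf : IsSpectralDensity f) (hg : IsSpectralDensity g) (F : ℝ → ℂ) :
    ∫ x, F x ∂specMeasure f g = ∫ x, ((f x + g x : ℝ) : ℂ) * F x := by
  rw [specMeasure, integral_withDensity_eq_integral_toReal_smul₀ (hf.aemeasurable_weight hg)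
    (.of_forall fun _ => ENNReal.ofReal_lt_top)]
  refine integral_congr_ae ?_
  filter_upwards [hf.ae_add_nonneg hg] with x hx
  rw [ENNReal.toReal_ofReal hx, Complex.real_smul]

lemma memLp_of_bounded (hf : IsSpectralDensity f) (hg : IsSpectralDensity g) {h : ℝ → ℂ}
    (hm : AEStronglyMeasurable h) {K : ℝ} (hK : ∀ᵐ x, ‖h x‖ ≤ K) :
    MemLp h 2 (specMeasure f g) := by
  have := isFiniteMeasure_specMeasure hf hg
  exact MemLp.of_bound (hm.mono_ac specMeasure_absolutelyContinuous) K
    (specMeasure_absolutelyContinuous.ae_le hK)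

lemma memLp_of_mem_span (hf : IsSpectralDensity f) (hg : IsSpectralDensity g) {O : Set ℝ}
    {p : ℝ → ℂ} (hp : p ∈ Submodule.span ℂ (character '' O)) : MemLp p 2 (specMeasure f g) := by
  obtain ⟨K, hK⟩ := bounded_of_mem_span hp
  exact memLp_of_bounded hf hg (continuous_of_mem_span hp).aestronglyMeasurable (.of_forall hK)

lemma mem_L2s_of_mem_span (hf : IsSpectralDensity f) (hg : IsSpectralDensity g) {O : Set ℝ}
    {p : ℝ → ℂ} (hp : p ∈ Submodule.span ℂ (character '' O)) : p ∈ L2s O f g :=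
  ⟨memLp_of_mem_span hf hg hp, fun ε _ => ⟨p, hp, by simp⟩⟩

end Weight

/-! ### L₂ˢ(f+g) as a closed subspace of a Hilbert space. -/

/-- The trigonometric polynomials with frequencies in `O`, as a subspace of `L₂(μ)`. -/
def trigSubspace (O : Set ℝ) (μ : Measure ℝ) : Submodule ℂ (Lp ℂ 2 μ) where
  carrier := {u | ∃ p ∈ Submodule.span ℂ (character '' O), u =ᵐ[μ] p}
  zero_mem' := ⟨0, Submodule.zero_mem _, Lp.coeFn_zero ..⟩
  add_mem' := by
    rintro u v ⟨p, hp, hu⟩ ⟨q, hq, hv⟩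
    exact ⟨p + q, Submodule.add_mem _ hp hq, (Lp.coeFn_add u v).trans (hu.add hv)⟩
  smul_mem' := by
    rintro c u ⟨p, hp, hu⟩
    exact ⟨c • p, Submodule.smul_mem _ c hp, (Lp.coeFn_smul c u).trans (hu.const_smul c)⟩

/-- `L₂ˢ(f+g)` as a closed subspace of `L₂(f+g)`. -/
noncomputable def obsSubspace (O : Set ℝ) (μ : Measure ℝ) : Submodule ℂ (Lp ℂ 2 μ) :=
  (trigSubspace O μ).topologicalClosure

instance (O : Set ℝ) (μ : Measure ℝ) : CompleteSpace (obsSubspace O μ) :=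
  (Submodule.isClosed_topologicalClosure _).completeSpace_coe

section Obs

variable {f g : ℝ → ℝ} {O : Set ℝ}

lemma toLp_mem_trigSubspace {μ : Measure ℝ} {p : ℝ → ℂ}
    (hp : p ∈ Submodule.span ℂ (character '' O)) (hm : MemLp p 2 μ) :
    hm.toLp p ∈ trigSubspace O μ := ⟨p, hp, hm.coeFn_toLp⟩

lemma mem_L2s_iff (hf : IsSpectralDensity f) (hg : IsSpectralDensity g) {h : ℝ → ℂ}
    (hm : MemLp h 2 (specMeasure f g)) :
    h ∈ L2s O f g ↔ hm.toLp h ∈ obsSubspace O (specMeasure f g) := by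
  rw [obsSubspace, ← SetLike.mem_coe, Submodule.topologicalClosure_coe, EMetric.mem_closure_iff]
  constructor
  · rintro ⟨-, H⟩ ε hε
    -- Closure asks for a strict inequality, `L2s` only provides `≤`.
    obtain ⟨δ, hδ, hδε⟩ := exists_between hε
    obtain ⟨p, hp, hpe⟩ := H δ hδ
    have hpm := memLp_of_mem_span hf hg hp
    refine ⟨hpm.toLp p, toLp_mem_trigSubspace hp hpm, ?_⟩
    rw [Lp.edist_toLp_toLp]
    exact hpe.trans_lt hδε
  · intro H
    refine ⟨hm, fun ε hε => ?_⟩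
    obtain ⟨u, ⟨p, hp, hup⟩, hu⟩ := H ε hε
    refine ⟨p, hp, ?_⟩
    rw [Lp.edist_def] at hu
    refine le_of_eq_of_le (eLpNorm_congr_ae ?_) hu.le
    filter_upwards [hm.coeFn_toLp, hup] with x h1 h2
    simp [h1, h2]

end Obs

/-- The characteristic `A f / (f + g)` of the estimate from all observation times. -/
noncomputable def fullChar (A : ℝ → ℂ) (f g : ℝ → ℝ) (x : ℝ) : ℂ :=
  A x * ((f x / (f x + g x) : ℝ) : ℂ)

/-! ### The error as a squared distance. -/

section Forms

variable {f g : ℝ → ℝ} {O : Set ℝ} {A : ℝ → ℂ}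

lemma norm_sq_toLp {μ : Measure ℝ} {h : ℝ → ℂ} (hm : MemLp h 2 μ) :
    ENNReal.ofReal (‖hm.toLp h‖ ^ 2) = ∫⁻ x, ‖h x‖ₑ ^ 2 ∂μ := by
  rw [ENNReal.ofReal_pow (norm_nonneg _), ofReal_norm, Lp.enorm_toLp,
    eLpNorm_eq_lintegral_rpow_enorm_toReal two_ne_zero ENNReal.ofNat_ne_top,
    ← ENNReal.rpow_natCast, ← ENNReal.rpow_mul]
  simp

lemma memLp_two_of_lintegral_lt_top {μ : Measure ℝ} {h : ℝ → ℂ} (hm : AEStronglyMeasurable h μ)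
    (hh : ∫⁻ x, ‖h x‖ₑ ^ 2 ∂μ < ⊤) : MemLp h 2 μ := by
  refine ⟨hm, ?_⟩
  rw [eLpNorm_lt_top_iff_lintegral_rpow_enorm_lt_top two_ne_zero ENNReal.ofNat_ne_top]
  simpa using hh

lemma aestronglyMeasurable_ofReal {u : ℝ → ℝ} (hu : AEMeasurable u) :
    AEStronglyMeasurable (fun x => ((u x : ℝ) : ℂ)) :=
  (Complex.measurable_ofReal.comp_aemeasurable hu).aestronglyMeasurable

lemma memLp_fullChar (hf : IsSpectralDensity f) (hg : IsSpectralDensity g) (hA : Continuous A)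
    {K : ℝ} (hK : ∀ x, ‖A x‖ ≤ K) : MemLp (fullChar A f g) 2 (specMeasure f g) := by
  refine memLp_of_bounded hf hg (K := K) (hA.aestronglyMeasurable.mul
    (aestronglyMeasurable_ofReal (hf.1.aemeasurable.div (hf.aemeasurable_add hg)))) ?_
  filter_upwards [hf.2, hg.2] with x h1 h2
  rw [fullChar, norm_mul, Complex.norm_real, Real.norm_of_nonneg (by positivity)]
  exact (mul_le_of_le_one_right (norm_nonneg _)
    (div_le_one_of_le₀ (by linarith) (by positivity))).trans (hK x)

/-- Pointwise completion of the square. If f + g = 0, both densities vanish and division by zero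
returns 0, so both sides are 0. -/
lemma norm_sq_split {f g : ℝ} (hf : 0 ≤ f) (hg : 0 ≤ g) (A h : ℂ) :
    ‖A - h‖ ^ 2 * f + ‖h‖ ^ 2 * g =
      (f + g) * ‖h - A * ((f / (f + g) : ℝ) : ℂ)‖ ^ 2 + f * g / (f + g) * ‖A‖ ^ 2 := by
  rcases (add_nonneg hf hg).eq_or_lt with h0 | h0
  · obtain rfl : f = 0 := by linarith
    obtain rfl : g = 0 := by linarith
    simp
  · simp only [← Complex.normSq_eq_norm_sq, Complex.normSq_apply, Complex.sub_re, Complex.sub_im,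
      Complex.re_mul_ofReal, Complex.im_mul_ofReal]
    field_simp
    ring

lemma integrable_formQ (hf : IsSpectralDensity f) (hg : IsSpectralDensity g) (hA : Continuous A)
    {K : ℝ} (hK : ∀ x, ‖A x‖ ≤ K) :
    Integrable fun x => f x * g x / (f x + g x) * ‖A x‖ ^ 2 := by
  refine Integrable.mono' (g := fun x => f x * K ^ 2) (hf.1.mul_const _)
    (((hf.1.aemeasurable.mul hg.1.aemeasurable).div (hf.aemeasurable_add hg)).mul
      (by fun_prop : Continuous fun x => ‖A x‖ ^ 2).aemeasurable).aestronglyMeasurable ?_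
  filter_upwards [hf.2, hg.2] with x h1 h2
  rw [Real.norm_of_nonneg (by positivity)]
  have h3 : f x * g x / (f x + g x) ≤ f x := by
    rw [mul_div_assoc]
    exact mul_le_of_le_one_right h1 (div_le_one_of_le₀ (by linarith) (by positivity))
  gcongr
  exact hK x

/-- Both f dλ and g dλ are absolutely continuous with respect to (f+g) dλ, since neither density is
negative. -/
lemma Delta_congr (hf : IsSpectralDensity f) (hg : IsSpectralDensity g) {h h' : ℝ → ℂ}
    (hh : h =ᵐ[specMeasure f g] h') : Delta A h f g = Delta A h' f g := by
  have := (specMeasure_ae_iff hf hg).1 hh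
  unfold Delta
  congr 2 <;> refine lintegral_congr_ae ?_ <;> filter_upwards [this, hf.2, hg.2] with x h1 h2 h3
  · rcases h2.eq_or_lt with h4 | h4
    · simp [← h4]
    · rw [h1 (by linarith)]
  · rcases h3.eq_or_lt with h4 | h4
    · simp [← h4]
    · rw [h1 (by linarith)]

lemma formQ_nonneg (hf : IsSpectralDensity f) (hg : IsSpectralDensity g) : 0 ≤ formQ A f g := by
  refine mul_nonneg (by positivity) (integral_nonneg_of_ae ?_)
  filter_upwards [hf.2, hg.2] with x h1 h2
  simp only [Pi.zero_apply]
  positivity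

/-- Completing the square in the mean-square error. -/
lemma Delta_eq (hf : IsSpectralDensity f) (hg : IsSpectralDensity g) (hA : Continuous A)
    {K : ℝ} (hK : ∀ x, ‖A x‖ ≤ K) {h : ℝ → ℂ} (hm : MemLp h 2 (specMeasure f g)) :
    Delta A h f g = ENNReal.ofReal (1 / (2 * Real.pi) *
      ‖hm.toLp h - (memLp_fullChar hf hg hA hK).toLp _‖ ^ 2 + formQ A f g) := by
  -- `h` is measurable only modulo null sets of (f+g) dλ; a strongly measurable representative makes
  -- the Lebesgue integrands measurable.
  obtain ⟨u, hu, hhu⟩ := hm.aestronglyMeasurable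
  have hbm : AEStronglyMeasurable (fullChar A f g) := hA.aestronglyMeasurable.mul
    (aestronglyMeasurable_ofReal (hf.1.aemeasurable.div (hf.aemeasurable_add hg)))
  have hum : MemLp u 2 (specMeasure f g) := (memLp_congr_ae hhu).1 hm
  have e1 : hm.toLp h = hum.toLp u := MemLp.toLp_congr _ _ hhu
  have hpi : 0 ≤ 1 / (2 * Real.pi) := by positivity
  rw [Delta_congr hf hg hhu, e1, ← MemLp.toLp_sub, formQ, ← mul_add,
    ENNReal.ofReal_mul hpi, Delta, ← mul_add]
  congr 1
  have hint := integrable_formQ hf hg hA hK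
  have hnn : 0 ≤ᵐ[volume] fun x => f x * g x / (f x + g x) * ‖A x‖ ^ 2 := by
    filter_upwards [hf.2, hg.2] with x h1 h2
    simp only [Pi.zero_apply]
    positivity
  have hm1 : AEMeasurable fun x => ‖A x - u x‖ₑ ^ 2 * ENNReal.ofReal (f x) :=
    ((hA.aestronglyMeasurable.sub hu.aestronglyMeasurable).enorm.pow_const 2).mul
      hf.1.aemeasurable.ennreal_ofReal
  have hm2 : AEMeasurable fun x => ‖(u - fullChar A f g) x‖ₑ ^ 2 :=
    (hu.aestronglyMeasurable.sub hbm).enorm.pow_const 2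
  have hm3 : AEMeasurable fun x =>
      ENNReal.ofReal (f x + g x) * ‖(u - fullChar A f g) x‖ₑ ^ 2 :=
    (hf.aemeasurable_weight hg).mul hm2
  rw [ENNReal.ofReal_add (by positivity) (integral_nonneg_of_ae hnn), norm_sq_toLp,
    ofReal_integral_eq_lintegral_ofReal hint hnn,
    lintegral_specMeasure hf hg hm2, ← lintegral_add_left' hm1,
    ← lintegral_add_left' hm3]
  refine lintegral_congr_ae ?_
  filter_upwards [hf.2, hg.2] with x h1 h2
  simp only [Pi.sub_apply, ← ofReal_norm]
  change ENNReal.ofReal ‖A x - u x‖ ^ 2 * _ + ENNReal.ofReal ‖u x‖ ^ 2 * _ = _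
  have h3 := add_nonneg h1 h2
  simp only [← ENNReal.ofReal_pow (norm_nonneg _)]
  rw [← ENNReal.ofReal_mul (by positivity), ← ENNReal.ofReal_mul (by positivity),
    ← ENNReal.ofReal_mul (by positivity), ← ENNReal.ofReal_add (by positivity) (by positivity),
    ← ENNReal.ofReal_add (by positivity) (by positivity), norm_sq_split h1 h2]
  rfl

/-! ### The form domain as an orthogonal complement -/

lemma memLp_div_weight (hf : IsSpectralDensity f) (hg : IsSpectralDensity g) {X : ℝ → ℂ}
    (hX : X ∈ formDomain O f g) :
    MemLp (fun x => X x / ((f x + g x : ℝ) : ℂ)) 2 (specMeasure f g) := by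
  have hm : AEStronglyMeasurable (fun x => X x / ((f x + g x : ℝ) : ℂ)) :=
    (hX.1.aemeasurable.div
      (aestronglyMeasurable_ofReal (hf.aemeasurable_add hg)).aemeasurable).aestronglyMeasurable
  refine memLp_two_of_lintegral_lt_top (hm.mono_ac specMeasure_absolutelyContinuous) ?_
  rw [lintegral_specMeasure hf hg (hm.enorm.pow_const 2)]
  refine (lintegral_mono_ae ?_).trans_lt hX.2.1
  filter_upwards [hf.ae_add_nonneg hg] with x hx
  rcases hx.eq_or_lt with h0 | h0
  · simp [← h0]
  · simp only [← ofReal_norm]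
    rw [norm_div, Complex.norm_real, Real.norm_of_nonneg hx,
      ← ENNReal.ofReal_pow (by positivity), ← ENNReal.ofReal_pow (by positivity),
      ← ENNReal.ofReal_mul hx, ← ENNReal.ofReal_div_of_pos h0]
    refine ENNReal.ofReal_le_ofReal (le_of_eq ?_)
    field_simp

/-- In [0, ∞] a nonzero number divided by 0 is ∞, which a finite integral allows only on a null set.
-/
lemma eq_zero_of_mem_formDomain (hf : IsSpectralDensity f) (hg : IsSpectralDensity g) {X : ℝ → ℂ}
    (hX : X ∈ formDomain O f g) : ∀ᵐ x, f x + g x = 0 → X x = 0 := by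
  have := ae_lt_top' ((hX.1.enorm.pow_const 2).div (hf.aemeasurable_weight hg)) hX.2.1.ne
  filter_upwards [this] with x hx h0
  by_contra hne
  simp [h0, ENNReal.div_zero, hne] at hx

/-- The element `X / (f + g)` of `L₂(f+g)` for `X` in the form domain. -/
noncomputable def divWeight (hf : IsSpectralDensity f) (hg : IsSpectralDensity g) {X : ℝ → ℂ}
    (hX : X ∈ formDomain O f g) : Lp ℂ 2 (specMeasure f g) :=
  (memLp_div_weight hf hg hX).toLp _

lemma inner_toLp (hf : IsSpectralDensity f) (hg : IsSpectralDensity g) {u v : ℝ → ℂ}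
    (hu : MemLp u 2 (specMeasure f g)) (hv : MemLp v 2 (specMeasure f g)) :
    inner ℂ (hu.toLp u) (hv.toLp v) = ∫ x, ((f x + g x : ℝ) : ℂ) * (v x * conj (u x)) := by
  rw [L2.inner_def, ← integral_specMeasure hf hg]
  refine integral_congr_ae ?_
  filter_upwards [hu.coeFn_toLp, hv.coeFn_toLp] with x h1 h2
  rw [h1, h2, RCLike.inner_apply]

/-- Conjugating `character t` gives the kernel of `timeFn`, so the value at t is, up to 1/(2π), the
inner product with `character t`. Vanishing for all t in `O` is orthogonality to the generators,
hence to their closed span. -/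
lemma obsSubspace_orthogonal_iff (hf : IsSpectralDensity f) (hg : IsSpectralDensity g)
    {u : ℝ → ℂ} (hu : MemLp u 2 (specMeasure f g)) :
    hu.toLp u ∈ (obsSubspace O (specMeasure f g))ᗮ ↔
      ∀ t ∈ O, timeFn (fun x => ((f x + g x : ℝ) : ℂ) * u x) t = 0 := by
  have hch : ∀ t ∈ O, character t ∈ Submodule.span ℂ (character '' O) :=
    fun t ht => Submodule.subset_span ⟨t, ht, rfl⟩
  have key : ∀ t (ht : t ∈ O), timeFn (fun x => ((f x + g x : ℝ) : ℂ) * u x) t =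
      (1 / (2 * Real.pi) : ℝ) *
        inner ℂ ((memLp_of_mem_span hf hg (hch t ht)).toLp _) (hu.toLp u) := by
    intro t ht
    rw [inner_toLp hf hg, timeFn]
    simp_rw [conj_character, mul_assoc]
  have hpi : (((1 / (2 * Real.pi) : ℝ)) : ℂ) ≠ 0 := by
    rw [Complex.ofReal_ne_zero]; positivity
  rw [obsSubspace, Submodule.orthogonal_closure]
  constructor
  · intro h t ht
    rw [key t ht, (Submodule.mem_orthogonal _ _).1 h _ (toLp_mem_trigSubspace (hch t ht) _),
      mul_zero]
  · intro h
    rw [Submodule.mem_orthogonal]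
    have hspan : ∀ p ∈ Submodule.span ℂ (character '' O), ∀ hp : MemLp p 2 (specMeasure f g),
        inner ℂ (hp.toLp p) (hu.toLp u) = 0 := by
      intro p hp
      induction hp using Submodule.span_induction with
      | mem x hx =>
        intro hp
        obtain ⟨t, ht, rfl⟩ := hx
        have := h t ht
        rw [key t ht] at this
        exact (mul_eq_zero.1 this).resolve_left hpi
      | zero =>
        intro hp
        rw [MemLp.toLp_zero hp, inner_zero_left]
      | add x y hx hy h1 h2 =>
        intro hp
        have hx' := memLp_of_mem_span hf hg hx
        have hy' := memLp_of_mem_span hf hg hy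
        rw [MemLp.toLp_add hx' hy', inner_add_left, h1, h2, add_zero]
      | smul c x hx h1 =>
        intro hp
        have hx' := memLp_of_mem_span hf hg hx
        rw [MemLp.toLp_const_smul c hx', inner_smul_left, h1, mul_zero]
    rintro v ⟨p, hp, hv⟩
    rw [← hspan p hp (memLp_of_mem_span hf hg hp)]
    congr 1
    exact Lp.ext (hv.trans (MemLp.coeFn_toLp _).symm)

lemma divWeight_mem_orthogonal (hf : IsSpectralDensity f) (hg : IsSpectralDensity g) {X : ℝ → ℂ}
    (hX : X ∈ formDomain O f g) :
    divWeight hf hg hX ∈ (obsSubspace O (specMeasure f g))ᗮ := by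
  rw [divWeight, obsSubspace_orthogonal_iff hf hg]
  intro t ht
  rw [← hX.2.2 t ht, timeFn, timeFn]
  congr 1
  refine integral_congr_ae ?_
  filter_upwards [eq_zero_of_mem_formDomain hf hg hX] with x hx
  by_cases h0 : f x + g x = 0
  · simp [h0, hx h0]
  · rw [mul_div_cancel₀ _ (by exact_mod_cast h0)]

/-- With `divWeight_mem_orthogonal`, this makes division by the weight a correspondence between the
form domain and the orthogonal complement; the preimage of `u` is (f+g) u. -/
lemma exists_formDomain_of_mem_orthogonal (hf : IsSpectralDensity f) (hg : IsSpectralDensity g)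
    {u : Lp ℂ 2 (specMeasure f g)} (hu : u ∈ (obsSubspace O (specMeasure f g))ᗮ) :
    ∃ (X : ℝ → ℂ) (hX : X ∈ formDomain O f g), divWeight hf hg hX = u := by
  have hum : AEStronglyMeasurable u := (Lp.stronglyMeasurable u).aestronglyMeasurable
  have hX : (fun x => ((f x + g x : ℝ) : ℂ) * u x) ∈ formDomain O f g := by
    refine ⟨(aestronglyMeasurable_ofReal (hf.aemeasurable_add hg)).mul hum, ?_, ?_⟩
    · have h1 := norm_sq_toLp (Lp.memLp u)
      rw [lintegral_specMeasure hf hg (hum.enorm.pow_const 2)] at h1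
      refine lt_of_eq_of_lt (lintegral_congr_ae ?_) (h1.symm.trans_lt ENNReal.ofReal_lt_top)
      filter_upwards [hf.ae_add_nonneg hg] with x hx
      rcases hx.eq_or_lt with h0 | h0
      · simp [← h0]
      · simp only [← ofReal_norm]
        rw [norm_mul, Complex.norm_real, Real.norm_of_nonneg hx,
          ← ENNReal.ofReal_pow (by positivity), ← ENNReal.ofReal_pow (by positivity),
          ← ENNReal.ofReal_mul hx, ← ENNReal.ofReal_div_of_pos h0]
        congr 1
        field_simp
    · exact (obsSubspace_orthogonal_iff hf hg (Lp.memLp u)).1 (by rwa [Lp.toLp_coeFn])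
  refine ⟨_, hX, Lp.ext ?_⟩
  refine (MemLp.coeFn_toLp (memLp_div_weight hf hg hX)).trans ((specMeasure_ae_iff hf hg).2 ?_)
  exact .of_forall fun x hx => mul_div_cancel_left₀ _ (by exact_mod_cast hx.ne')

/-- The arguments swap because `inner` is conjugate-linear in the first one. -/
lemma formB_eq (hf : IsSpectralDensity f) (hg : IsSpectralDensity g) {X Y : ℝ → ℂ}
    (hX : X ∈ formDomain O f g) (hY : Y ∈ formDomain O f g) :
    formB f g X Y = (1 / (2 * Real.pi) : ℝ) * inner ℂ (divWeight hf hg hY) (divWeight hf hg hX) := by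
  rw [divWeight, divWeight, inner_toLp hf hg, formB]
  congr 2
  ext x
  by_cases h0 : f x + g x = 0
  · simp [h0]
  · have : ((f x + g x : ℝ) : ℂ) ≠ 0 := by exact_mod_cast h0
    rw [map_div₀, Complex.conj_ofReal, Complex.ofReal_div, Complex.ofReal_one]
    field_simp

lemma formR_eq (hf : IsSpectralDensity f) (hg : IsSpectralDensity g) (hA : Continuous A)
    {K : ℝ} (hK : ∀ x, ‖A x‖ ≤ K) {Y : ℝ → ℂ} (hY : Y ∈ formDomain O f g) :
    formR A f g Y = (1 / (2 * Real.pi) : ℝ) *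
      inner ℂ (divWeight hf hg hY) ((memLp_fullChar hf hg hA hK).toLp _) := by
  rw [divWeight, inner_toLp hf hg, formR]
  congr 2
  ext x
  by_cases h0 : f x + g x = 0
  · simp [h0]
  · have : ((f x + g x : ℝ) : ℂ) ≠ 0 := by exact_mod_cast h0
    rw [map_div₀, Complex.conj_ofReal, fullChar, Complex.ofReal_div]
    field_simp

end Forms

/-! ### Solving B c = R a by orthogonal projection. -/

section Optimal

variable {f g : ℝ → ℝ} {O : Set ℝ} {A : ℝ → ℂ}

/-- C / (f+g) is the component of `fullChar` orthogonal to the observations. Solvability for every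
pair of densities lets the extremal hypothesis be applied anywhere in D. -/
lemma exists_isBinvRa (hf : IsSpectralDensity f) (hg : IsSpectralDensity g) (hA : Continuous A)
    {K : ℝ} (hK : ∀ x, ‖A x‖ ≤ K) : ∃ C, IsBinvRa O A f g C := by
  set B := (memLp_fullChar hf hg hA hK).toLp _
  set V := obsSubspace O (specMeasure f g)
  obtain ⟨C, hC, hCu⟩ := exists_formDomain_of_mem_orthogonal hf hg
    (V.sub_starProjection_mem_orthogonal B)
  refine ⟨C, hC, fun Y hY => ?_⟩
  rw [formB_eq hf hg hC hY, formR_eq hf hg hA hK hY, hCu, inner_sub_right,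
    Submodule.inner_left_of_mem_orthogonal (V.starProjection_apply_mem B)
      (divWeight_mem_orthogonal hf hg hY), sub_zero]

variable {C : ℝ → ℂ}

/-- The equation says that the difference is orthogonal to the whole orthogonal complement; a closed
subspace is its own double complement. -/
lemma IsBinvRa.fullChar_sub_mem (hf : IsSpectralDensity f) (hg : IsSpectralDensity g)
    (hA : Continuous A) {K : ℝ} (hK : ∀ x, ‖A x‖ ≤ K) (hC : IsBinvRa O A f g C) :
    (memLp_fullChar hf hg hA hK).toLp _ - divWeight hf hg hC.1 ∈
      obsSubspace O (specMeasure f g) := by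
  rw [← (obsSubspace O (specMeasure f g)).orthogonal_orthogonal, Submodule.mem_orthogonal]
  intro u hu
  obtain ⟨Y, hY, rfl⟩ := exists_formDomain_of_mem_orthogonal hf hg hu
  have h := hC.2 Y hY
  rw [formB_eq hf hg hC.1 hY, formR_eq hf hg hA hK hY] at h
  have hpi : (((1 / (2 * Real.pi) : ℝ)) : ℂ) ≠ 0 := by
    rw [Complex.ofReal_ne_zero]; positivity
  rw [inner_sub_right, mul_left_cancel₀ hpi h, sub_self]

lemma IsBinvRa.extremValue_eq (hf : IsSpectralDensity f) (hg : IsSpectralDensity g)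
    (hC : IsBinvRa O A f g C) :
    extremValue A f g C =
      1 / (2 * Real.pi) * ‖divWeight hf hg hC.1‖ ^ 2 + formQ A f g := by
  rw [extremValue, ← hC.2 C hC.1, formB_eq hf hg hC.1 hC.1, Complex.re_ofReal_mul,
    ← inner_self_eq_norm_sq (𝕜 := ℂ)]
  rfl

lemma IsBinvRa.extremValue_nonneg (hf : IsSpectralDensity f) (hg : IsSpectralDensity g)
    (hC : IsBinvRa O A f g C) :
    0 ≤ extremValue A f g C := by
  rw [hC.extremValue_eq hf hg]
  have := formQ_nonneg (A := A) hf hg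
  positivity

lemma memLp_charFormula (hf : IsSpectralDensity f) (hg : IsSpectralDensity g)
    (hA : Continuous A) {K : ℝ} (hK : ∀ x, ‖A x‖ ≤ K) (hC : C ∈ formDomain O f g) :
    MemLp (charFormula A f g C) 2 (specMeasure f g) :=
  (memLp_fullChar hf hg hA hK).sub (memLp_div_weight hf hg hC)

lemma toLp_charFormula (hf : IsSpectralDensity f) (hg : IsSpectralDensity g)
    (hA : Continuous A) {K : ℝ} (hK : ∀ x, ‖A x‖ ≤ K) (hC : C ∈ formDomain O f g) :
    (memLp_charFormula hf hg hA hK hC).toLp _ =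
      (memLp_fullChar hf hg hA hK).toLp _ - divWeight hf hg hC :=
  MemLp.toLp_sub (memLp_fullChar hf hg hA hK) (memLp_div_weight hf hg hC)

lemma IsBinvRa.charFormula_mem (hf : IsSpectralDensity f) (hg : IsSpectralDensity g)
    (hA : Continuous A) {K : ℝ} (hK : ∀ x, ‖A x‖ ≤ K) (hC : IsBinvRa O A f g C) :
    charFormula A f g C ∈ L2s O f g := by
  rw [mem_L2s_iff hf hg (memLp_charFormula hf hg hA hK hC.1), toLp_charFormula hf hg hA hK hC.1]
  exact hC.fullChar_sub_mem hf hg hA hK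

/-- The error of an estimate is the optimal error plus the squared distance to `charFormula`. -/
lemma IsBinvRa.Delta_eq_add (hf : IsSpectralDensity f) (hg : IsSpectralDensity g)
    (hA : Continuous A) {K : ℝ} (hK : ∀ x, ‖A x‖ ≤ K) (hC : IsBinvRa O A f g C) {h : ℝ → ℂ}
    (hm : MemLp h 2 (specMeasure f g)) (hh : h ∈ L2s O f g) :
    Delta A h f g = ENNReal.ofReal (extremValue A f g C + 1 / (2 * Real.pi) *
      ‖hm.toLp h - (memLp_charFormula hf hg hA hK hC.1).toLp _‖ ^ 2) := by
  -- Pythagoras: `h - charFormula` lies in the observation subspace, and `charFormula - fullChar =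
  -- -C / (f+g)` is orthogonal to it.
  have h0 : inner ℂ (hm.toLp h - (memLp_charFormula hf hg hA hK hC.1).toLp _)
      (-divWeight hf hg hC.1) = 0 := by
    rw [inner_neg_right, toLp_charFormula hf hg hA hK hC.1, Submodule.inner_right_of_mem_orthogonal
      (Submodule.sub_mem _ ((mem_L2s_iff hf hg hm).1 hh) (hC.fullChar_sub_mem hf hg hA hK))
      (divWeight_mem_orthogonal hf hg hC.1), neg_zero]
  have h1 := norm_add_sq_eq_norm_sq_add_norm_sq_of_inner_eq_zero _ _ h0
  rw [Delta_eq hf hg hA hK hm, hC.extremValue_eq hf hg]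
  have e : hm.toLp h - (memLp_fullChar hf hg hA hK).toLp _ =
      (hm.toLp h - (memLp_charFormula hf hg hA hK hC.1).toLp _) + -divWeight hf hg hC.1 := by
    rw [toLp_charFormula hf hg hA hK hC.1]; abel
  rw [e, sq, h1, norm_neg]
  congr 1
  ring

lemma IsBinvRa.Delta_charFormula (hf : IsSpectralDensity f) (hg : IsSpectralDensity g)
    (hA : Continuous A) {K : ℝ} (hK : ∀ x, ‖A x‖ ≤ K) (hC : IsBinvRa O A f g C) :
    Delta A (charFormula A f g C) f g = ENNReal.ofReal (extremValue A f g C) := by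
  rw [hC.Delta_eq_add hf hg hA hK (memLp_charFormula hf hg hA hK hC.1)
    (hC.charFormula_mem hf hg hA hK), sub_self]
  simp

lemma IsBinvRa.isOptimal (hf : IsSpectralDensity f) (hg : IsSpectralDensity g)
    (hA : Continuous A) {K : ℝ} (hK : ∀ x, ‖A x‖ ≤ K) (hC : IsBinvRa O A f g C) :
    IsOptimal O A (charFormula A f g C) f g := by
  refine ⟨hC.charFormula_mem hf hg hA hK, fun h hh => ?_⟩
  rw [hC.Delta_charFormula hf hg hA hK, hC.Delta_eq_add hf hg hA hK hh.1 hh]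
  exact ENNReal.ofReal_le_ofReal (le_add_of_nonneg_right (by positivity))

lemma IsOptimal.Delta_eq_optDelta {h : ℝ → ℂ} (hh : IsOptimal O A h f g) :
    Delta A h f g = optDelta O A f g :=
  le_antisymm (le_iInf₂ hh.2) (iInf₂_le h hh.1)

lemma IsBinvRa.optDelta_eq (hf : IsSpectralDensity f) (hg : IsSpectralDensity g)
    (hA : Continuous A) {K : ℝ} (hK : ∀ x, ‖A x‖ ≤ K) (hC : IsBinvRa O A f g C) :
    optDelta O A f g = ENNReal.ofReal (extremValue A f g C) := by
  rw [← (hC.isOptimal hf hg hA hK).Delta_eq_optDelta, hC.Delta_charFormula hf hg hA hK]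

/-- Trigonometric polynomials come arbitrarily close to the optimal error. -/
lemma exists_mem_span_Delta_le (hf : IsSpectralDensity f) (hg : IsSpectralDensity g)
    (hA : Continuous A) {K : ℝ} (hK : ∀ x, ‖A x‖ ≤ K) (hC : IsBinvRa O A f g C) {δ : ℝ}
    (hδ : 0 < δ) : ∃ p ∈ Submodule.span ℂ (character '' O),
      Delta A p f g ≤ ENNReal.ofReal (extremValue A f g C + δ) := by
  have hmem := hC.charFormula_mem hf hg hA hK
  have hm := memLp_charFormula hf hg hA hK hC.1
  obtain ⟨p, hp, hle⟩ := hmem.2 (ENNReal.ofReal (Real.sqrt δ)) (by simpa using hδ)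
  have hpm := memLp_of_mem_span hf hg hp
  refine ⟨p, hp, ?_⟩
  rw [hC.Delta_eq_add hf hg hA hK hpm (mem_L2s_of_mem_span hf hg hp)]
  refine ENNReal.ofReal_le_ofReal (add_le_add_right ?_ _)
  have h1 : ‖hpm.toLp p - hm.toLp _‖ ≤ Real.sqrt δ := by
    rw [norm_sub_rev, ← MemLp.toLp_sub, Lp.norm_toLp]
    exact ENNReal.toReal_le_of_le_ofReal (Real.sqrt_nonneg _) hle
  have h2 : ‖hpm.toLp p - hm.toLp _‖ ^ 2 ≤ δ := by
    calc _ ≤ Real.sqrt δ ^ 2 := by gcongr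
      _ = δ := Real.sq_sqrt hδ.le
  have h3 : 1 / (2 * Real.pi) ≤ 1 := by
    rw [div_le_one (by positivity)]
    linarith [Real.pi_gt_three]
  calc _ ≤ 1 * δ := by gcongr
    _ = δ := one_mul δ

end Optimal

/-! ### Convexity of the classes and affinity of the error -/

section Convex

variable {f g f' g' : ℝ → ℝ} {A : ℝ → ℂ} {t : ℝ}

/-- The segment between two densities. -/
def mixDensity (t : ℝ) (f f' : ℝ → ℝ) (x : ℝ) : ℝ := (1 - t) * f x + t * f' x

lemma IsSpectralDensity.mix (hf : IsSpectralDensity f) (hf' : IsSpectralDensity f') (h0 : 0 ≤ t)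
    (h1 : t ≤ 1) : IsSpectralDensity (mixDensity t f f') := by
  refine ⟨(hf.1.const_mul _).add (hf'.1.const_mul _), ?_⟩
  filter_upwards [hf.2, hf'.2] with x h2 h3
  exact add_nonneg (mul_nonneg (by linarith) h2) (mul_nonneg h0 h3)

lemma contamClass_mix {ε P : ℝ} {f₁ : ℝ → ℝ} (hf : f ∈ contamClass ε P f₁)
    (hf' : f' ∈ contamClass ε P f₁) (h0 : 0 ≤ t) (h1 : t ≤ 1) :
    mixDensity t f f' ∈ contamClass ε P f₁ := by
  obtain ⟨hd, ⟨w, hw, hfw⟩, hP⟩ := hf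
  obtain ⟨hd', ⟨w', hw', hfw'⟩, hP'⟩ := hf'
  refine ⟨hd.mix hd' h0 h1, ⟨mixDensity t w w', hw.mix hw' h0 h1, ?_⟩, ?_⟩
  · filter_upwards [hfw, hfw'] with x h2 h3
    rw [mixDensity, mixDensity, h2, h3]
    ring
  · simp only [mixDensity]
    rw [integral_add (hd.1.const_mul _) (hd'.1.const_mul _), integral_const_mul,
      integral_const_mul]
    nlinarith

lemma l1Class_mix {ε : ℝ} {g₁ : ℝ → ℝ} (hg₁ : IsSpectralDensity g₁) (hg : g ∈ l1Class ε g₁)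
    (hg' : g' ∈ l1Class ε g₁) (h0 : 0 ≤ t) (h1 : t ≤ 1) :
    mixDensity t g g' ∈ l1Class ε g₁ := by
  obtain ⟨hd, hP⟩ := hg
  obtain ⟨hd', hP'⟩ := hg'
  refine ⟨hd.mix hd' h0 h1, ?_⟩
  have i1 : Integrable fun x => (1 - t) * |g x - g₁ x| := (hd.1.sub hg₁.1).abs.const_mul _
  have i2 : Integrable fun x => t * |g' x - g₁ x| := (hd'.1.sub hg₁.1).abs.const_mul _
  have h2 : ∫ x, |mixDensity t g g' x - g₁ x| ≤
      ∫ x, ((1 - t) * |g x - g₁ x| + t * |g' x - g₁ x|) := by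
    refine integral_mono (((hd.mix hd' h0 h1).1.sub hg₁.1).abs) (i1.add i2) fun x => ?_
    have e : mixDensity t g g' x - g₁ x = (1 - t) * (g x - g₁ x) + t * (g' x - g₁ x) := by
      rw [mixDensity]; ring
    have h3 : 0 ≤ 1 - t := by linarith
    calc _ ≤ |(1 - t) * (g x - g₁ x)| + |t * (g' x - g₁ x)| := e ▸ abs_add_le _ _
      _ = _ := by rw [abs_mul, abs_mul, abs_of_nonneg h3, abs_of_nonneg h0]
  rw [integral_add i1 i2, integral_const_mul, integral_const_mul] at h2
  have hpi : 0 ≤ 1 / (2 * Real.pi) := by positivity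
  nlinarith [mul_le_mul_of_nonneg_left h2 hpi]

lemma lintegral_mix {F : ℝ → ℝ≥0∞} (hF : Measurable F) (hf : IsSpectralDensity f)
    (hf' : IsSpectralDensity f') (h0 : 0 ≤ t) (h1 : t ≤ 1) :
    ∫⁻ x, F x * ENNReal.ofReal (mixDensity t f f' x) =
      ENNReal.ofReal (1 - t) * (∫⁻ x, F x * ENNReal.ofReal (f x)) +
        ENNReal.ofReal t * ∫⁻ x, F x * ENNReal.ofReal (f' x) := by
  have m1 : AEMeasurable fun x => F x * ENNReal.ofReal (f x) :=
    hF.aemeasurable.mul hf.1.aemeasurable.ennreal_ofReal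
  have m2 : AEMeasurable fun x => F x * ENNReal.ofReal (f' x) :=
    hF.aemeasurable.mul hf'.1.aemeasurable.ennreal_ofReal
  rw [← lintegral_const_mul'' _ m1, ← lintegral_const_mul'' _ m2,
    ← lintegral_add_left' (m1.const_mul _)]
  refine lintegral_congr_ae ?_
  filter_upwards [hf.2, hf'.2] with x h2 h3
  have h4 : 0 ≤ 1 - t := by linarith
  rw [mixDensity, ENNReal.ofReal_add (mul_nonneg h4 h2) (mul_nonneg h0 h3),
    ENNReal.ofReal_mul h4, ENNReal.ofReal_mul h0]
  ring

/-- The error is linear in the densities once `p` is fixed. A trigonometric polynomial serves as a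
common `p`, being admissible for every pair. -/
lemma Delta_mix (hA : Continuous A) {p : ℝ → ℂ} (hp : Continuous p) (hf : IsSpectralDensity f)
    (hf' : IsSpectralDensity f') (hg : IsSpectralDensity g) (hg' : IsSpectralDensity g')
    (h0 : 0 ≤ t) (h1 : t ≤ 1) :
    Delta A p (mixDensity t f f') (mixDensity t g g') =
      ENNReal.ofReal (1 - t) * Delta A p f g + ENNReal.ofReal t * Delta A p f' g' := by
  have m1 : Measurable fun x => ‖A x - p x‖ₑ ^ 2 := (by fun_prop : Continuous _).measurable
  have m2 : Measurable fun x => ‖p x‖ₑ ^ 2 := (by fun_prop : Continuous _).measurable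
  rw [Delta, lintegral_mix m1 hf hf' h0 h1, lintegral_mix m2 hg hg' h0 h1, Delta, Delta]
  ring

end Convex

/-- The entire function `Γ` is not identically zero on the real line, so its real zeros form a null
set; elsewhere a finite quotient forces f + g > 0. -/
lemma Minimality.ae_pos {f g : ℝ → ℝ} (hf : IsSpectralDensity f) (hg : IsSpectralDensity g)
    (h : Minimality f g) : ∀ᵐ x, 0 < f x + g x := by
  obtain ⟨α, Γ, -, hΓ, -, -, ⟨x₀, hx₀⟩, hfin⟩ := h
  have hcont : Continuous fun x : ℝ => Γ x := hΓ.continuous.comp Complex.continuous_ofReal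
  have hana : AnalyticOnNhd ℝ (fun x : ℝ => Γ x) Set.univ := fun x _ =>
    ((hΓ.analyticAt (x : ℂ)).restrictScalars (𝕜 := ℝ)).comp (f := fun y : ℝ => (y : ℂ))
      (Complex.ofRealCLM.analyticAt x)
  have hne : ∀ᵐ x : ℝ, Γ x ≠ 0 := by
    have := ae_restrict_le_codiscreteWithin (μ := volume) MeasurableSet.univ
      (hana.preimage_zero_mem_codiscrete hx₀)
    rwa [Measure.restrict_univ] at this
  have hlt := ae_lt_top' ((hcont.enorm.measurable.pow_const 2).aemeasurable.div (hf.aemeasurable_weight hg)) hfin.ne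
  filter_upwards [hne, hlt] with x h1 h2
  by_contra h0
  simp [ENNReal.ofReal_of_nonpos (not_lt.1 h0), ENNReal.div_zero, h1] at h2

/-! ### The saddle point inequality. -/

section Saddle

variable {f g f' g' : ℝ → ℝ} {O : Set ℝ} {A C : ℝ → ℂ}

/-- Here `d` stands for the squared distance to the optimum at (f, g) and `W` for the error at (f',
g'). Cancelling V leaves (1 - t) d / (2π) + t W ≤ t V + t². Hence W ≤ V + t and, for t ≤ 1/2, d ≤ 4π
t (V + 1); the choice of `t` puts both excesses below ε. -/
lemma exists_step_of_pos {V ε : ℝ} (hV : 0 ≤ V) (hε : 0 < ε) :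
    ∃ t : ℝ, 0 < t ∧ t ≤ 1 ∧ ∀ d W : ℝ, 0 ≤ d → 0 ≤ W →
      (1 - t) * (V + 1 / (2 * Real.pi) * d) + t * W ≤ V + t ^ 2 → d ≤ ε ∧ W ≤ V + ε := by
  have hpi := Real.pi_pos
  have hM : 1 ≤ 4 * Real.pi * (V + 1) + 1 := le_add_of_nonneg_left (by positivity)
  obtain ⟨t, ht, ht2, htM⟩ : ∃ t : ℝ, 0 < t ∧ t ≤ 1 / 2 ∧
      t * (4 * Real.pi * (V + 1) + 1) ≤ ε :=
    ⟨min (1 / 2) (ε / (4 * Real.pi * (V + 1) + 1)), lt_min (by norm_num) (by positivity),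
      min_le_left _ _, (le_div_iff₀ (by positivity)).1 (min_le_right _ _)⟩
  have htε : t ≤ ε := (le_mul_of_one_le_right ht.le hM).trans htM
  refine ⟨t, ht, by linarith, fun d W hd hW hle => ?_⟩
  obtain ⟨e, he, rfl⟩ : ∃ e, 0 ≤ e ∧ d = 2 * Real.pi * e :=
    ⟨d / (2 * Real.pi), by positivity, by field_simp⟩
  have h6 : 1 / (2 * Real.pi) * (2 * Real.pi * e) = e := by field_simp
  rw [h6] at hle
  constructor
  · have h1 : 1 / 2 * e ≤ t * (V + 1) := by nlinarith [mul_nonneg ht.le hW]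
    nlinarith [mul_le_mul_of_nonneg_left h1 hpi.le]
  · have h1 : t * W ≤ t * (V + t) := by nlinarith
    exact (le_of_mul_le_mul_left h1 ht).trans (by linarith)

/-- If moving from `(f, g)` towards `(f', g')` does not increase the optimal error, then
trigonometric polynomials approximating the optimal characteristic for `(f, g)` can be chosen with
almost no larger error at `(f', g')`. -/
lemma exists_mem_span_near (hf : IsSpectralDensity f) (hg : IsSpectralDensity g)
    (hf' : IsSpectralDensity f') (hg' : IsSpectralDensity g') (hA : Continuous A) {K : ℝ}
    (hK : ∀ x, ‖A x‖ ≤ K) (hC : IsBinvRa O A f g C)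
    (hmax : ∀ t, 0 ≤ t → t ≤ 1 → ∀ C', IsBinvRa O A (mixDensity t f f') (mixDensity t g g') C' →
      extremValue A (mixDensity t f f') (mixDensity t g g') C' ≤ extremValue A f g C)
    {ε : ℝ} (hε : 0 < ε) :
    ∃ (p : ℝ → ℂ) (hp : p ∈ Submodule.span ℂ (character '' O)),
      ‖(memLp_of_mem_span hf hg hp).toLp p - (memLp_charFormula hf hg hA hK hC.1).toLp _‖ ^ 2 ≤ ε ∧
      1 / (2 * Real.pi) * ‖(memLp_of_mem_span hf' hg' hp).toLp p -
        (memLp_fullChar hf' hg' hA hK).toLp _‖ ^ 2 + formQ A f' g' ≤ extremValue A f g C + ε := by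
  have hV := hC.extremValue_nonneg hf hg
  have hpi := Real.pi_pos
  obtain ⟨t, ht, ht1, harith⟩ := exists_step_of_pos hV hε
  have hft := hf.mix hf' ht.le ht1
  have hgt := hg.mix hg' ht.le ht1
  obtain ⟨C', hC'⟩ := exists_isBinvRa (O := O) hft hgt hA hK
  -- The tolerance t² is of smaller order than the weight t of (f', g'), so it survives division by
  -- t.
  obtain ⟨p, hp, hle⟩ := exists_mem_span_Delta_le hft hgt hA hK hC' (pow_pos ht 2)
  refine ⟨p, hp, ?_⟩
  have hQ := formQ_nonneg (A := A) hf' hg'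
  rw [Delta_mix hA (continuous_of_mem_span hp) hf hf' hg hg' ht.le ht1,
    hC.Delta_eq_add hf hg hA hK (memLp_of_mem_span hf hg hp) (mem_L2s_of_mem_span hf hg hp),
    Delta_eq hf' hg' hA hK (memLp_of_mem_span hf' hg' hp),
    ← ENNReal.ofReal_mul (by linarith), ← ENNReal.ofReal_mul ht.le] at hle
  have h1t : 0 ≤ 1 - t := sub_nonneg.2 ht1
  have hVt : 0 ≤ extremValue A (mixDensity t f f') (mixDensity t g g') C' + t ^ 2 :=
    add_nonneg (hC'.extremValue_nonneg hft hgt) (sq_nonneg t)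
  rw [← ENNReal.ofReal_add (by positivity) (by positivity), ENNReal.ofReal_le_ofReal_iff hVt] at hle
  exact harith _ _ (sq_nonneg _) (by positivity)
    (hle.trans (add_le_add_left (hmax t ht.le ht1 C' hC') _))

/-- The saddle point inequality: if `(f, g)` maximizes the optimal error on the segment to
`(f', g')`, then the optimal characteristic for `(f, g)` is admissible for `(f', g')`, and its error
there is at most the optimal error for `(f, g)`. -/
theorem charFormula_mem_and_Delta_le (hf : IsSpectralDensity f) (hg : IsSpectralDensity g)
    (hf' : IsSpectralDensity f') (hg' : IsSpectralDensity g') (hpos : ∀ᵐ x, 0 < f x + g x)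
    (hA : Continuous A) {K : ℝ} (hK : ∀ x, ‖A x‖ ≤ K) (hC : IsBinvRa O A f g C)
    (hmax : ∀ t, 0 ≤ t → t ≤ 1 → ∀ C', IsBinvRa O A (mixDensity t f f') (mixDensity t g g') C' →
      extremValue A (mixDensity t f f') (mixDensity t g g') C' ≤ extremValue A f g C) :
    charFormula A f g C ∈ L2s O f' g' ∧
      Delta A (charFormula A f g C) f' g' ≤ ENNReal.ofReal (extremValue A f g C) := by
  have hpi := Real.pi_pos
  set μ := specMeasure f g
  set μ' := specMeasure f' g'
  have hm := memLp_charFormula hf hg hA hK hC.1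
  -- Polynomials, seen in L₂(f'+g'), that are within 1/(n+1) of the optimal characteristic in
  -- L₂(f+g). One function `p` represents both classes, which ties the two spaces together.
  set S : ℕ → Set (Lp ℂ 2 μ') := fun n => {u | ∃ p ∈ Submodule.span ℂ (character '' O),
    u =ᵐ[μ'] p ∧ ∃ v : Lp ℂ 2 μ, v =ᵐ[μ] p ∧ ‖v - hm.toLp _‖ ≤ 1 / ((n : ℝ) + 1)}
  obtain ⟨x, y, hxS, hxy, hy⟩ := exists_tendsto_of_antitone_convex (K := S)
    (c := (memLp_fullChar hf' hg' hA hK).toLp _)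
    -- This is the squared distance to `fullChar` that makes the error at (f', g') equal to
    -- `extremValue A f g C`.
    (R := 2 * Real.pi * (extremValue A f g C - formQ A f' g'))
    (by
      rintro n m hnm u ⟨p, hp, hu, v, hv, hle⟩
      exact ⟨p, hp, hu, v, hv, hle.trans (by gcongr)⟩)
    (by
      rintro n u₁ ⟨p₁, hp₁, hu₁, v₁, hv₁, hle₁⟩ u₂ ⟨p₂, hp₂, hu₂, v₂, hv₂, hle₂⟩
      refine ⟨(2⁻¹ : ℂ) • (p₁ + p₂), Submodule.smul_mem _ _ (Submodule.add_mem _ hp₁ hp₂),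
        (Lp.coeFn_smul _ _).trans (((Lp.coeFn_add _ _).trans (hu₁.add hu₂)).const_smul _),
        (2⁻¹ : ℂ) • (v₁ + v₂),
        (Lp.coeFn_smul _ _).trans (((Lp.coeFn_add _ _).trans (hv₁.add hv₂)).const_smul _), ?_⟩
      have e : (2⁻¹ : ℂ) • (v₁ + v₂) - hm.toLp _ =
          (2⁻¹ : ℂ) • ((v₁ - hm.toLp _) + (v₂ - hm.toLp _)) := by module
      rw [e, norm_smul, norm_inv, RCLike.norm_ofNat]
      have := norm_add_le (v₁ - hm.toLp _) (v₂ - hm.toLp _)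
      linarith)
    (by
      intro n ε hε
      have hδ : 0 < min (ε / (2 * Real.pi)) ((1 / ((n : ℝ) + 1)) ^ 2) := by positivity
      obtain ⟨p, hp, h1, h2⟩ := exists_mem_span_near hf hg hf' hg' hA hK hC hmax hδ
      refine ⟨_, ⟨p, hp, (memLp_of_mem_span hf' hg' hp).coeFn_toLp, _,
        (memLp_of_mem_span hf hg hp).coeFn_toLp, ?_⟩, ?_⟩
      · exact le_of_sq_le_sq (h1.trans (min_le_right _ _)) (by positivity)
      · have h3 := h2.trans (add_le_add_right (min_le_left _ _) _)
        have h4 := mul_le_mul_of_nonneg_left h3 (by positivity : 0 ≤ 2 * Real.pi)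
        have h5 : 2 * Real.pi * (ε / (2 * Real.pi)) = ε := by field_simp
        have h6 : ∀ r : ℝ, 2 * Real.pi * (1 / (2 * Real.pi) * r) = r := fun r => by field_simp
        rw [mul_add, mul_add, h5, h6] at h4
        linarith)
  choose p hp hxp v hvp hv using hxS
  have hvlim : Tendsto v atTop (𝓝 (hm.toLp _)) := by
    rw [tendsto_iff_norm_sub_tendsto_zero]
    exact squeeze_zero (fun _ => norm_nonneg _) hv tendsto_one_div_add_atTop_nhds_zero_nat
  obtain ⟨ns, hns, hae⟩ := (tendstoInMeasure_of_tendsto_Lp hvlim).exists_seq_tendsto_ae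
  obtain ⟨ms, hms, hae'⟩ := (tendstoInMeasure_of_tendsto_Lp
    (hxy.comp hns.tendsto_atTop)).exists_seq_tendsto_ae
  -- Since f + g > 0 almost everywhere, convergence μ-a.e. holds Lebesgue-a.e. and so passes to μ',
  -- where it identifies the limit `y`.
  have hpt : ∀ᵐ s, Tendsto (fun i => p (ns i) s) atTop (𝓝 (charFormula A f g C s)) := by
    have h1 : ∀ᵐ s ∂μ, Tendsto (fun i => p (ns i) s) atTop (𝓝 (charFormula A f g C s)) := by
      filter_upwards [hae, hm.coeFn_toLp, ae_all_iff.2 hvp] with s h1 h2 h3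
      simpa only [h3, h2] using h1
    filter_upwards [(specMeasure_ae_iff hf hg).1 h1, hpos] with s h2 h3 using h2 h3
  have heq : y =ᵐ[μ'] charFormula A f g C := by
    filter_upwards [hae', ae_all_iff.2 hxp, specMeasure_absolutelyContinuous.ae_le hpt]
      with s h1 h2 h3
    simp only [Function.comp_apply, h2] at h1
    exact tendsto_nhds_unique h1 (h3.comp hms.tendsto_atTop)
  have hm' : MemLp (charFormula A f g C) 2 μ' := (memLp_congr_ae heq).1 (Lp.memLp y)
  have hyL : hm'.toLp _ = y := Lp.ext (hm'.coeFn_toLp.trans heq.symm)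
  refine ⟨(mem_L2s_iff hf' hg' hm').2 ?_, ?_⟩
  · rw [hyL]
    exact mem_closure_of_tendsto hxy (.of_forall fun n => ⟨p n, hp n, hxp n⟩)
  · rw [Delta_eq hf' hg' hA hK hm', hyL]
    refine ENNReal.ofReal_le_ofReal ?_
    have h1 := mul_le_mul_of_nonneg_left hy (by positivity : 0 ≤ 1 / (2 * Real.pi))
    have h2 : 1 / (2 * Real.pi) * (2 * Real.pi * (extremValue A f g C - formQ A f' g')) =
      extremValue A f g C - formQ A f' g' := by field_simp
    linarith

end Saddle

end MissingObsFiltering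

/-! ### From the saddle point to the minimax property. -/

open MissingObsFiltering in
theorem mainTheorem5
    {s : ℕ} (M N : Fin s → ℝ) (hM : ∀ l, 0 ≤ M l) (hN : ∀ l, 0 ≤ N l)
    (a : ℝ → ℂ)
    (ha1 : IntegrableOn a (funcSupport M N))
    (ha2 : IntegrableOn (fun t => t * ‖a t‖ ^ 2) (funcSupport M N))
    (A : ℝ → ℂ) (hA : A = symbolA (funcSupport M N) a)
    (ε₁ ε₂ P₁ : ℝ) (hε₁ : 0 ≤ ε₁) (hε₁' : ε₁ ≤ 1)
    (f₁ g₁ : ℝ → ℝ) (hf₁ : IsSpectralDensity f₁) (hg₁ : IsSpectralDensity g₁)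
    (f₀ g₀ : ℝ → ℝ) (hf₀ : f₀ ∈ contamClass ε₁ P₁ f₁) (hg₀ : g₀ ∈ l1Class ε₂ g₁)
    (hmin : Minimality f₀ g₀)
    -- `C⁰` is the transform of `(B⁰)⁻¹ R⁰ a`
    (C₀ : ℝ → ℂ) (hC₀ : IsBinvRa (observed M N) A f₀ g₀ C₀)
    -- `h_f(f₀, g₀)` and `h_g(f₀, g₀)` are bounded
    (hhf : ∃ K : ℝ, ∀ᵐ x, hf A f₀ g₀ C₀ x ≤ K)
    (hhg : ∃ K : ℝ, ∀ᵐ x, hg A f₀ g₀ C₀ x ≤ K)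
    -- the equations for the least favorable densities
    (α₁ α₂ : ℝ) (hα₁ : α₁ ≠ 0) (φ Ψ : ℝ → ℝ)
    (hφ : ∀ᵐ x, φ x ≤ 0) (hφ0 : ∀ᵐ x, (1 - ε₁) * f₁ x < f₀ x → φ x = 0)
    (hΨ : ∀ᵐ x, |Ψ x| ≤ 1) (hΨs : ∀ᵐ x, g₀ x ≠ g₁ x → Ψ x = Real.sign (g₀ x - g₁ x))
    (heqf : ∀ᵐ x, ‖A x * (g₀ x : ℂ) + C₀ x‖ = (f₀ x + g₀ x) * (φ x + α₁⁻¹))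
    (k : ℕ) (hk : k = 1 ∨ k = 2)
    (heqg : ∀ᵐ x, ‖A x * (f₀ x : ℂ) - C₀ x‖ ^ 2 = (f₀ x + g₀ x) ^ k * Ψ x * α₂)
    -- the pair solves the constrained optimization problem
    (hext : SolvesExtrem (observed M N) A (contamClass ε₁ P₁ f₁ ×ˢ l1Class ε₂ g₁) f₀ g₀ C₀) :
    LeastFavorable (observed M N) A (contamClass ε₁ P₁ f₁ ×ˢ l1Class ε₂ g₁) f₀ g₀ ∧
    IsOptimal (observed M N) A (charFormula A f₀ g₀ C₀) f₀ g₀ ∧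
    MinimaxRobust (observed M N) A (contamClass ε₁ P₁ f₁ ×ˢ l1Class ε₂ g₁)
      (charFormula A f₀ g₀ C₀) := by
  have hAc : Continuous A := hA ▸ continuous_symbolA ha1
  have hAK : ∀ x, ‖A x‖ ≤ ∫ t in funcSupport M N, ‖a t‖ := hA ▸ norm_symbolA_le a
  have hopt := hC₀.isOptimal hf₀.1 hg₀.1 hAc hAK
  have hval := hC₀.Delta_charFormula hf₀.1 hg₀.1 hAc hAK
  -- The class D is convex, so the extremal hypothesis controls the whole segment from (f₀, g₀) to
  -- `q`.
  have hsaddle : ∀ q ∈ contamClass ε₁ P₁ f₁ ×ˢ l1Class ε₂ g₁,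
      charFormula A f₀ g₀ C₀ ∈ L2s (observed M N) q.1 q.2 ∧
      Delta A (charFormula A f₀ g₀ C₀) q.1 q.2 ≤ Delta A (charFormula A f₀ g₀ C₀) f₀ g₀ := by
    rintro q ⟨hq1, hq2⟩
    rw [hval]
    exact charFormula_mem_and_Delta_le hf₀.1 hg₀.1 hq1.1 hq2.1 (hmin.ae_pos hf₀.1 hg₀.1) hAc hAK
      hC₀ fun t h0 h1 C' hC' => hext.2.2 (mixDensity t f₀ q.1, mixDensity t g₀ q.2)
        ⟨contamClass_mix hf₀ hq1 h0 h1, l1Class_mix hg₁ hg₀ hq2 h0 h1⟩ C' hC'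
  refine ⟨⟨hext.1, ⟨_, hopt, hopt.Delta_eq_optDelta⟩, fun q hq => ?_⟩, hopt,
    fun q hq => (hsaddle q hq).1, ⟨(f₀, g₀), hext.1, fun q hq => (hsaddle q hq).2⟩, fun h hh => ?_⟩
  · obtain ⟨C, hC⟩ := exists_isBinvRa (O := observed M N) hq.1.1 hq.2.1 hAc hAK
    rw [hC.optDelta_eq hq.1.1 hq.2.1 hAc hAK, hC₀.optDelta_eq hf₀.1 hg₀.1 hAc hAK]
    exact ENNReal.ofReal_le_ofReal (hext.2.2 q hq C hC)
  · have hle : Delta A h f₀ g₀ ≤ ⨆ q ∈ contamClass ε₁ P₁ f₁ ×ˢ l1Class ε₂ g₁,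
        Delta A h q.1 q.2 :=
      le_iSup₂_of_le (f₀, g₀) hext.1 le_rfl
    have hh₀ : h ∈ L2s (observed M N) f₀ g₀ := hh (f₀, g₀) hext.1
    -- The worst error of h⁰ is its error at (f₀, g₀). There h⁰ is optimal, so any `h` does no
    -- better at that pair, hence no better in the worst case.
    exact (iSup₂_le fun q hq => (hsaddle q hq).2).trans ((hopt.2 h hh₀).trans hle)
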